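/- Let $\mathbf{k}$ be a field, $V$ a $\mathbf{k}$-vector space of finite dimension $d$, and $W\subset GL(V)$ an irreducible finite reflection group. Here a reflection is an element of $GL(V)$ of finite order whose fixed subspace has codimension $1$; a finite subgroup of $GL(V)$ is a reflection group if its order is not divisible by $\operatorname{char}\mathbf{k}$ and it is generated by reflections (the trivial group is allowed); irreducible means that $V$ is an irreducible representation of $W$. For a subgroup $H\subseteq W$ put $V^H=\{v\in V : hv=v \text{ for all } h\in H\}$; $H$ is called a stabilizer subgroup if $H=\{g\in W : gv=v\}$ for some $v\in V$. Assume that $\mathbf{k}$ is infinite or, more generally, that some vector of $V$ has trivial stabilizer in $W$. Then: 1. For every normal subgroup $N$ of $W$: $N$ is a stabilizer subgroup if and only if $W/N$ is a reflection group on $V^N$, that is, $W/N$ acts faithfully on $V^N$ and its image in $GL(V^N)$ is a reflection group. 2. The normal stabilizer subgroups of $W$ are exactly $\{e\}$ and $W$, and the characteristic polynomial of the representation $V$ of $W$ is $\varphi_W(t)=t^d-1$. Here $$\varphi_W(t)=\sum_{H}\ \sum_{\mathbf{f}:\ \max\mathbf{f}=[H]}(-1)^{|\mathbf{f}|-1}\bigl(t^{\dim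 V^H}-1\bigr),$$ where $H$ runs over the normal stabilizer subgroups of $W$, and $\mathbf{f}$ over the non-empty chains with largest element $[H]$ in the poset of $W$-conjugacy classes of stabilizer subgroups, in which $[H_1]\le[H_2]$ if $H_1$ is contained in a conjugate of $H_2$. -/

import Mathlib

noncomputable section

namespace ReflectionReps

/-! ### Stabilizer subgroups of a representation -/

section Stabilizers

variable {k G V : Type*} [Field k] [Group G] [AddCommGroup V] [Module k V]

/-- The stabilizer `{g | g · v = v}` of a vector `v`. -/
def stab (ρ : Representation k G V) (v : V) : Subgroup G where
  carrier := {g | ρ g v = v}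
  one_mem' := by simp
  mul_mem' {a b} ha hb := by
    simp only [Set.mem_ofPred_eq] at ha hb ⊢
    rw [map_mul, Module.End.mul_apply, hb, ha]
  inv_mem' {a} ha := by
    simp only [Set.mem_ofPred_eq] at ha ⊢
    conv_lhs => rw [← ha]
    simp

/-- `V_H`: the set of vectors whose stabilizer is exactly `H`. -/
def exactlyFixedBy (ρ : Representation k G V) (H : Subgroup G) : Set V :=
  {v | H = stab ρ v}

/-- `V^H`: the subspace of vectors fixed by all elements of `H`. -/
abbrev fixedSpace (ρ : Representation k G V) (H : Subgroup G) : Submodule k V :=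
  Representation.invariants (ρ.comp H.subtype)

/-- `H` is a stabilizer subgroup with respect to `ρ` if `V_H` is not empty. -/
def IsStabilizerSubgroup (ρ : Representation k G V) (H : Subgroup G) : Prop :=
  (exactlyFixedBy ρ H).Nonempty

/-- The set of stabilizer subgroups. -/
abbrev StabilizerSubgroup (ρ : Representation k G V) : Type _ :=
  {H : Subgroup G // IsStabilizerSubgroup ρ H}

end Stabilizers

/-! ### Conjugacy classes of stabilizer subgroups -/

section Orbits

variable {k G V : Type*} [Field k] [Group G] [AddCommGroup V] [Module k V]

/-- The conjugate `g H g⁻¹`. -/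
def conjSubgroup (g : G) (H : Subgroup G) : Subgroup G :=
  H.map (MulAut.conj g).toMonoidHom

theorem conjSubgroup_one (H : Subgroup G) : conjSubgroup 1 H = H := by
  ext x; simp [conjSubgroup]

theorem conjSubgroup_mul (g h : G) (H : Subgroup G) :
    conjSubgroup (g * h) H = conjSubgroup g (conjSubgroup h H) := by
  simp only [conjSubgroup, Subgroup.map_map]
  congr 1
  ext x
  simp

theorem conjSubgroup_mono (g : G) {H K : Subgroup G} (h : H ≤ K) :
    conjSubgroup g H ≤ conjSubgroup g K :=
  Subgroup.map_mono h

theorem card_conjSubgroup (g : G) (H : Subgroup G) :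
    Nat.card (conjSubgroup g H) = Nat.card H :=
  Nat.card_congr (H.equivMapOfInjective _ (MulAut.conj g).injective).symm.toEquiv

/-- Conjugacy of stabilizer subgroups. -/
def conjSetoid (ρ : Representation k G V) : Setoid (StabilizerSubgroup ρ) where
  r H K := ∃ g : G, H.1 = conjSubgroup g K.1
  iseqv :=
    { refl := fun H => ⟨1, (conjSubgroup_one H.1).symm⟩
      symm := by
        rintro H K ⟨g, hg⟩
        exact ⟨g⁻¹, by rw [hg, ← conjSubgroup_mul, inv_mul_cancel, conjSubgroup_one]⟩
      trans := by
        rintro H K L ⟨g, hg⟩ ⟨h, hh⟩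
        exact ⟨g * h, by rw [hg, hh, conjSubgroup_mul]⟩ }

/-- The set of orbits of the conjugation action of `G` on its stabilizer subgroups. -/
def StabilizerOrbit (ρ : Representation k G V) : Type _ := Quotient (conjSetoid ρ)

/-- The orbit of a stabilizer subgroup. -/
def StabilizerOrbit.mk {ρ : Representation k G V} (H : StabilizerSubgroup ρ) :
    StabilizerOrbit ρ :=
  Quotient.mk (conjSetoid ρ) H

/-- `[H] ≤ [K]` if `H` is contained in a conjugate of `K`; the orbit of `{e}` is smallest, as in
the lattice of the subspaces `V^H` ordered by reverse inclusion. -/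
instance {ρ : Representation k G V} [Finite G] : PartialOrder (StabilizerOrbit ρ) where
  le := Quotient.lift₂ (fun H K => ∃ g : G, H.1 ≤ conjSubgroup g K.1) (by
    rintro H K H' K' ⟨a, ha⟩ ⟨b, hb⟩
    apply propext
    constructor
    · rintro ⟨g, hg⟩
      refine ⟨a⁻¹ * (g * b), ?_⟩
      rw [conjSubgroup_mul, conjSubgroup_mul, ← hb]
      have := conjSubgroup_mono a⁻¹ hg
      rwa [ha, ← conjSubgroup_mul, inv_mul_cancel, conjSubgroup_one] at this
    · rintro ⟨g, hg⟩
      refine ⟨a * (g * b⁻¹), ?_⟩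
      have hb' : K'.1 = conjSubgroup b⁻¹ K.1 := by
        rw [hb, ← conjSubgroup_mul, inv_mul_cancel, conjSubgroup_one]
      rw [conjSubgroup_mul, conjSubgroup_mul, ← hb', ha]
      exact conjSubgroup_mono a hg)
  le_refl x := by
    induction x using Quotient.inductionOn with
    | h H => exact ⟨1, (conjSubgroup_one H.1).ge⟩
  le_trans x y z := by
    induction x, y using Quotient.inductionOn₂ with
    | h H K =>
      induction z using Quotient.inductionOn with
      | h L =>
        rintro ⟨g, hg⟩ ⟨h, hh⟩
        refine ⟨g * h, hg.trans ?_⟩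
        rw [conjSubgroup_mul]
        exact conjSubgroup_mono g hh
  le_antisymm x y := by
    induction x, y using Quotient.inductionOn₂ with
    | h H K =>
      rintro ⟨g, hg⟩ ⟨h, hh⟩
      refine Quotient.sound ⟨g, ?_⟩
      refine SetLike.coe_injective (Set.eq_of_subset_of_ncard_le hg ?_ (Set.toFinite _))
      change Nat.card (conjSubgroup g K.1) ≤ Nat.card H.1
      rw [card_conjSubgroup, ← card_conjSubgroup h H.1]
      exact Subgroup.card_le_of_le hh

theorem StabilizerOrbit.mk_le_mk {ρ : Representation k G V} [Finite G]
    (H K : StabilizerSubgroup ρ) :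
    StabilizerOrbit.mk H ≤ StabilizerOrbit.mk K ↔ ∃ g : G, H.1 ≤ conjSubgroup g K.1 :=
  Iff.rfl

instance {ρ : Representation k G V} [Finite G] : Finite (StabilizerOrbit ρ) :=
  inferInstanceAs (Finite (Quotient (conjSetoid ρ)))

end Orbits

/-! ### The characteristic polynomial of a representation -/

section CharacteristicPolynomial

variable {k G V : Type*} [Field k] [Group G] [Finite G] [AddCommGroup V] [Module k V]

/-- The finite set of normal stabilizer subgroups. A normal subgroup is alone in its conjugacy
class, so this is also the set of one-element conjugacy classes of stabilizer subgroups. -/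
def normalStabilizers (ρ : Representation k G V) : Finset (StabilizerSubgroup ρ) :=
  Set.Finite.toFinset (s := {H | H.1.Normal}) (Set.toFinite _)

/-- The chains of the poset of orbits whose largest element is `x` (in particular they are
non-empty). -/
def chainsWithMax {ρ : Representation k G V} (x : StabilizerOrbit ρ) :
    Finset (Finset (StabilizerOrbit ρ)) :=
  Set.Finite.toFinset
    (s := {f | IsChain (· ≤ ·) (f : Set (StabilizerOrbit ρ)) ∧
      IsGreatest (f : Set (StabilizerOrbit ρ)) x}) (Set.toFinite _)

/-- The characteristic polynomial
`φ_ρ(t) = ∑_H ∑_{f, max f = H} (-1)^(|f| - 1) (t^(dim V^H) - 1)`, where `H` runs over the normal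
stabilizer subgroups and `f` over the chains of orbits with largest element `H`. -/
def characteristicPolynomial (ρ : Representation k G V) : Polynomial ℤ :=
  ∑ H ∈ normalStabilizers ρ, ∑ f ∈ chainsWithMax (StabilizerOrbit.mk H),
    (-1) ^ (f.card - 1) * (Polynomial.X ^ Module.finrank k (fixedSpace ρ H.1) - 1)

end CharacteristicPolynomial

/-! ### Reflection groups -/

section ReflectionGroups

variable {k V : Type*} [Field k] [AddCommGroup V] [Module k V]

/-- A reflection: an invertible linear map of finite order whose fixed subspace has
codimension `1`. -/
def IsReflection (g : LinearMap.GeneralLinearGroup k V) : Prop :=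
  IsOfFinOrder g ∧ Module.finrank k (V ⧸ LinearMap.fixedSubmodule (g : V →ₗ[k] V)) = 1

/-- A reflection group: a finite group of linear maps whose order is not divisible by the
characteristic of the field, and which is generated by reflections. -/
structure IsReflectionGroup (W : Subgroup (LinearMap.GeneralLinearGroup k V)) : Prop where
  finite : Finite W
  not_dvd_card : ¬ ringChar k ∣ Nat.card W
  closure_eq : Subgroup.closure {g | g ∈ W ∧ IsReflection g} = W

/-- A group `G` acting on `V` is a reflection group through this action if the action is faithful,
so that `G` is a subgroup of `GL(V)`, and this subgroup is a reflection group. -/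
def ActsAsReflectionGroup {G : Type*} [Group G] (ρ : Representation k G V) : Prop :=
  Function.Injective ρ ∧ IsReflectionGroup ρ.asGroupHom.range

/-- The given representation of a subgroup `W` of `GL(V)` on `V`. -/
def standardRep (W : Subgroup (LinearMap.GeneralLinearGroup k V)) : Representation k W V :=
  (Units.coeHom (V →ₗ[k] V)).comp W.subtype

end ReflectionGroups

end ReflectionReps

end

namespace ReflectionReps

open Representation

section Fixed

variable {k G V : Type*} [Field k] [Group G] [AddCommGroup V] [Module k V]
  {ρ : Representation k G V}

/-! For normal `N` the subspace `V^N` is `W`-stable, hence `0` or `V` by irreducibility, and by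
faithfulness it is `V` only for `N = {e}`. So every non-trivial normal `N` has `V^N = 0`; if it is
the stabilizer of `v`, then `v = 0` and `N = W`. Conversely `W` is the stabilizer of `0`, and `{e}`
is a stabilizer by the assumption on `k` or on a vector.

This also settles the other claims. If `N ≠ {e}`, then `W/N` acts on the zero space, where a
reflection group must be trivial, so again `N = W`; if `N = {e}`, the action is that of `W` on `V`.
In the polynomial, a non-trivial `H` contributes multiples of `t^0 - 1 = 0`, while `{e}` is the
bottom of the poset and has a single chain. -/

theorem mem_stab {v : V} {g : G} : g ∈ stab ρ v ↔ ρ g v = v := Iff.rfl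

theorem mem_fixedSpace {H : Subgroup G} {v : V} :
    v ∈ fixedSpace ρ H ↔ ∀ g ∈ H, ρ g v = v := by
  simp [fixedSpace, Representation.mem_invariants]

theorem fixedSpace_bot : fixedSpace ρ ⊥ = ⊤ := by
  ext v
  simp

theorem mem_fixedSpace_stab (v : V) : v ∈ fixedSpace ρ (stab ρ v) :=
  mem_fixedSpace.2 fun _ hg => hg

theorem stab_zero : stab ρ (0 : V) = ⊤ := by
  ext g
  simp [mem_stab]

theorem isStabilizerSubgroup_top : IsStabilizerSubgroup ρ ⊤ :=
  ⟨0, stab_zero.symm⟩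

theorem eq_top_of_isStabilizerSubgroup {H : Subgroup G} (hH : IsStabilizerSubgroup ρ H)
    (h : fixedSpace ρ H = ⊥) : H = ⊤ := by
  obtain ⟨v, rfl⟩ := hH
  have hv : v ∈ fixedSpace ρ (stab ρ v) := mem_fixedSpace_stab v
  rw [h, Submodule.mem_bot] at hv
  rw [hv, stab_zero]

/-- Normality makes the fixed space stable under all of `G`, so it is a subrepresentation. -/
theorem fixedSpace_eq_bot_or_top_of_normal (hirr : ρ.IsIrreducible) (N : Subgroup G)
    [N.Normal] : fixedSpace ρ N = ⊥ ∨ fixedSpace ρ N = ⊤ := by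
  let S : Subrepresentation ρ := ⟨fixedSpace ρ N, fun g _ hv => le_comap_invariants ρ N g hv⟩
  rcases hirr.eq_bot_or_eq_top S with h | h
  · exact Or.inl (congrArg Subrepresentation.toSubmodule h)
  · exact Or.inr (congrArg Subrepresentation.toSubmodule h)

theorem eq_bot_of_fixedSpace_eq_top (hρ : Function.Injective ρ) {N : Subgroup G}
    (h : fixedSpace ρ N = ⊤) : N = ⊥ := by
  refine (Subgroup.eq_bot_iff_forall N).2 fun g hg => hρ ?_
  ext v
  have hv : v ∈ fixedSpace ρ N := h ▸ Submodule.mem_top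
  simpa using mem_fixedSpace.1 hv g hg

/-- Over an infinite field, a faithful representation of a finite group has a vector with trivial
stabilizer. -/
theorem exists_stab_eq_bot [Finite G] [Infinite k] (hρ : Function.Injective ρ) :
    ∃ v : V, stab ρ v = ⊥ := by
  classical
  cases nonempty_fintype G
  -- The fixed spaces of the elements `g ≠ 1` are proper by faithfulness, and finitely many proper
  -- subspaces cannot cover `V` over an infinite field.
  let p : G → Submodule k V := fun g => LinearMap.ker (ρ g - 1)
  let s : Finset (Submodule k V) := (Finset.univ.filter fun g : G => g ≠ 1).image p
  have hs : ⊤ ∉ s := by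
    intro h
    obtain ⟨g, hg, hp⟩ := Finset.mem_image.1 h
    refine (Finset.mem_filter.1 hg).2 (hρ ?_)
    rw [map_one, ← sub_eq_zero]
    exact LinearMap.ker_eq_top.1 hp
  obtain ⟨v, hv⟩ := (Set.ne_univ_iff_exists_notMem _).1
    (Subspace.biUnion_ne_univ_of_top_notMem hs)
  refine ⟨v, (Subgroup.eq_bot_iff_forall _).2 fun g hg => ?_⟩
  by_contra hg1
  refine hv (Set.mem_biUnion (x := p g) ?_ ?_)
  · exact Finset.mem_coe.2 (Finset.mem_image_of_mem p (by simpa using hg1))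
  · simpa [p, sub_eq_zero] using mem_stab.1 hg

end Fixed

section Chains

variable {k G V : Type*} [Field k] [Group G] [AddCommGroup V] [Module k V] [Finite G]
  {ρ : Representation k G V}

theorem mem_normalStabilizers {H : StabilizerSubgroup ρ} :
    H ∈ normalStabilizers ρ ↔ H.1.Normal := by
  simp [normalStabilizers]

/-- A member of such a chain lies both below and above `x`. -/
theorem chainsWithMax_of_isBot {x : StabilizerOrbit ρ} (hx : IsBot x) :
    chainsWithMax x = {{x}} := by
  ext f
  simp only [chainsWithMax, Set.Finite.mem_toFinset, Set.mem_ofPred_eq, Finset.mem_singleton]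
  constructor
  · rintro ⟨-, hmem, hub⟩
    ext y
    rw [Finset.mem_singleton]
    exact ⟨fun hy => le_antisymm (hub hy) (hx y), fun hy => hy ▸ hmem⟩
  · rintro rfl
    simp

theorem isBot_mk_bot (h : IsStabilizerSubgroup ρ ⊥) :
    IsBot (StabilizerOrbit.mk (⟨⊥, h⟩ : StabilizerSubgroup ρ)) := by
  intro y
  induction y using Quotient.inductionOn with
  | h K => exact (StabilizerOrbit.mk_le_mk _ K).2 ⟨1, bot_le⟩

/-- If every non-trivial normal stabilizer subgroup has no non-zero fixed vector, only the trivial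
subgroup contributes to the characteristic polynomial. -/
theorem characteristicPolynomial_eq (h : IsStabilizerSubgroup ρ ⊥)
    (hN : ∀ N : Subgroup G, N.Normal → N ≠ ⊥ → fixedSpace ρ N = ⊥) :
    characteristicPolynomial ρ = Polynomial.X ^ Module.finrank k V - 1 := by
  rw [characteristicPolynomial, Finset.sum_eq_single ⟨⊥, h⟩]
  · rw [chainsWithMax_of_isBot (isBot_mk_bot h), Finset.sum_singleton, fixedSpace_bot]
    simp
  · intro H hH hne
    have hfix := hN H.1 (mem_normalStabilizers.1 hH) fun h0 => hne (Subtype.ext h0)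
    -- The factor `X ^ 0 - 1` kills each term, so these chains need not be counted.
    refine Finset.sum_eq_zero fun f _ => ?_
    rw [hfix]
    simp
  · exact fun hnot => absurd (mem_normalStabilizers.2 inferInstance) hnot

end Chains

/-! ### Reflection groups under linear equivalences, and on the zero space -/

section Transport

variable {k V V' : Type*} [Field k] [AddCommGroup V] [Module k V] [AddCommGroup V'] [Module k V']

/-- The isomorphism of general linear groups given by a linear equivalence. -/
def glCongr (e : V ≃ₗ[k] V') :
    LinearMap.GeneralLinearGroup k V ≃* LinearMap.GeneralLinearGroup k V' :=
  Units.mapEquiv (LinearEquiv.conjRingEquiv e).toMulEquiv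

theorem glCongr_apply (e : V ≃ₗ[k] V') (g : LinearMap.GeneralLinearGroup k V) (v : V) :
    (glCongr e g : V' →ₗ[k] V') (e v) = e ((g : V →ₗ[k] V) v) := by
  simp [glCongr]

/-- The equivalence `e` carries the fixed space of `g` onto that of its conjugate, so the
codimensions agree. -/
theorem IsReflection.map (e : V ≃ₗ[k] V') {g : LinearMap.GeneralLinearGroup k V}
    (hg : IsReflection g) : IsReflection (glCongr e g) := by
  refine ⟨(glCongr e).toMonoidHom.isOfFinOrder hg.1, hg.2 ▸ ?_⟩
  refine (LinearEquiv.finrank_eq (Submodule.Quotient.equiv _ _ e ?_)).symm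
  ext w
  obtain ⟨v, rfl⟩ := e.surjective w
  simp [glCongr_apply]

theorem IsReflectionGroup.map (e : V ≃ₗ[k] V') {W : Subgroup (LinearMap.GeneralLinearGroup k V)}
    (hW : IsReflectionGroup W) : IsReflectionGroup (W.map (glCongr e).toMonoidHom) where
  finite := by
    have := hW.finite
    exact (W.equivMapOfInjective _ (glCongr e).injective).toEquiv.finite_iff.1 this
  not_dvd_card := by
    have h : Nat.card (W.map (glCongr e).toMonoidHom) = Nat.card W :=
      (Nat.card_congr (W.equivMapOfInjective _ (glCongr e).injective).toEquiv).symm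
    exact h ▸ hW.not_dvd_card
  closure_eq := by
    refine le_antisymm ((Subgroup.closure_le _).2 fun g hg => hg.1) ?_
    conv_lhs => rw [← hW.closure_eq]
    rw [MonoidHom.map_closure]
    refine Subgroup.closure_mono ?_
    rintro _ ⟨g, hg, rfl⟩
    exact ⟨Subgroup.mem_map_of_mem _ hg.1, hg.2.map e⟩

/-- A group acts on the zero space as a reflection group if and only if it is trivial. -/
theorem actsAsReflectionGroup_iff_subsingleton [Subsingleton V] {G : Type*} [Group G]
    (σ : Representation k G V) : ActsAsReflectionGroup σ ↔ Subsingleton G := by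
  constructor
  · exact fun h => h.1.subsingleton
  · intro h
    have hr : σ.asGroupHom.range = ⊥ := Subsingleton.elim _ _
    refine ⟨Function.injective_of_subsingleton σ, ?_⟩
    rw [hr]
    refine ⟨inferInstance, ?_, le_antisymm ?_ bot_le⟩
    -- The group has order `1`, which only a characteristic equal to `1` could divide.
    · simpa using CharP.ringChar_ne_one
    · exact (Subgroup.closure_le _).2 fun g hg => hg.1

end Transport

section Standard

variable {k V : Type*} [Field k] [AddCommGroup V] [Module k V]
  {W : Subgroup (LinearMap.GeneralLinearGroup k V)}

theorem standardRep_injective : Function.Injective (standardRep W) :=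
  fun _ _ h => Subtype.ext (Units.ext h)

/-- `W ⧸ ⊥` and `V^⊥` are only isomorphic to `W` and `V`, so the image in `GL(V^⊥)` is identified
with the conjugate of `W` by `e`. -/
theorem actsAsReflectionGroup_quotient_bot (hW : IsReflectionGroup W) :
    ActsAsReflectionGroup ((standardRep W).quotientToInvariants ⊥) := by
  let e : V ≃ₗ[k] fixedSpace (standardRep W) ⊥ :=
    (LinearEquiv.ofTop _ fixedSpace_bot).symm
  set σ := (standardRep W).quotientToInvariants ⊥ with hσ
  have key : ∀ (g : W) (v : V), σ (QuotientGroup.mk g) (e v) = e ((g.1 : V →ₗ[k] V) v) :=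
    fun g v => Subtype.ext rfl
  have hmk : ∀ g : W, σ.asGroupHom (QuotientGroup.mk g) = glCongr e g.1 := by
    intro g
    refine Units.ext (LinearMap.ext fun w => ?_)
    obtain ⟨v, rfl⟩ := e.surjective w
    rw [glCongr_apply, asGroupHom_apply, key]
  constructor
  · intro x y hxy
    obtain ⟨g, rfl⟩ := QuotientGroup.mk_surjective x
    obtain ⟨h, rfl⟩ := QuotientGroup.mk_surjective y
    have h1 : glCongr e g.1 = glCongr e h.1 := by
      rw [← hmk, ← hmk]
      exact Units.ext (by simpa [asGroupHom_apply] using hxy)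
    exact congrArg _ (Subtype.ext ((glCongr e).injective h1))
  · have hr : σ.asGroupHom.range = W.map (glCongr e).toMonoidHom := by
      ext u
      constructor
      · rintro ⟨x, rfl⟩
        obtain ⟨g, rfl⟩ := QuotientGroup.mk_surjective x
        exact ⟨g.1, g.2, (hmk g).symm⟩
      · rintro ⟨g, hg, rfl⟩
        exact ⟨QuotientGroup.mk (⟨g, hg⟩ : W), hmk ⟨g, hg⟩⟩
    rw [hr]
    exact hW.map e

end Standard

end ReflectionReps

open ReflectionReps

theorem mainTheorem5 {k V : Type*} [Field k] [AddCommGroup V] [Module k V]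
    [FiniteDimensional k V] (d : ℕ) (hd : Module.finrank k V = d)
    (W : Subgroup (LinearMap.GeneralLinearGroup k V)) [Finite W]
    (hW : ReflectionReps.IsReflectionGroup W)
    (hirr : (ReflectionReps.standardRep W).IsIrreducible)
    (hk : Infinite k ∨ ∃ v : V, ReflectionReps.stab (ReflectionReps.standardRep W) v = ⊥) :
    (∀ (N : Subgroup W) [N.Normal],
      ReflectionReps.IsStabilizerSubgroup (ReflectionReps.standardRep W) N ↔
        ReflectionReps.ActsAsReflectionGroup
          ((ReflectionReps.standardRep W).quotientToInvariants N)) ∧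
    {H : Subgroup W |
      ReflectionReps.IsStabilizerSubgroup (ReflectionReps.standardRep W) H ∧ H.Normal} =
        {⊥, ⊤} ∧
    ReflectionReps.characteristicPolynomial (ReflectionReps.standardRep W) =
      Polynomial.X ^ d - 1 := by
  have hinj : Function.Injective (standardRep W) := standardRep_injective
  have hbot : IsStabilizerSubgroup (standardRep W) ⊥ := by
    have hex : ∃ v : V, stab (standardRep W) v = ⊥ :=
      hk.elim (fun _ => exists_stab_eq_bot hinj) id
    obtain ⟨v, hv⟩ := hex
    exact ⟨v, hv.symm⟩
  have hfix (N : Subgroup W) (hN : N.Normal) (hne : N ≠ ⊥) : fixedSpace (standardRep W) N = ⊥ :=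
    (fixedSpace_eq_bot_or_top_of_normal hirr N).resolve_right
      fun h => hne (eq_bot_of_fixedSpace_eq_top hinj h)
  refine ⟨fun N hN => ?_, ?_, hd ▸ characteristicPolynomial_eq hbot hfix⟩
  · by_cases hne : N = ⊥
    · subst hne
      exact iff_of_true hbot (actsAsReflectionGroup_quotient_bot hW)
    · have h0 := hfix N hN hne
      have : Subsingleton (fixedSpace (standardRep W) N) :=
        (Submodule.subsingleton_iff_eq_bot).2 h0
      -- On the zero space both sides of the equivalence amount to `N = ⊤`.
      rw [actsAsReflectionGroup_iff_subsingleton, QuotientGroup.subsingleton_iff]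
      exact ⟨fun h => eq_top_of_isStabilizerSubgroup h h0, fun h => h ▸ isStabilizerSubgroup_top⟩
  · ext H
    constructor
    · rintro ⟨hH, hn⟩
      by_cases hne : H = ⊥
      · exact Or.inl hne
      · exact Or.inr (eq_top_of_isStabilizerSubgroup hH (hfix H hn hne))
    · rintro (rfl | rfl)
      · exact ⟨hbot, inferInstance⟩
      · exact ⟨isStabilizerSubgroup_top, inferInstance⟩
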